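/- **Theorem.** A sequence $(a_n)_{n\ge 0}$ of real numbers is a *normalized Hausdorff moment sequence* if $a_n=\int_0^1 t^n\,d\mu(t)$ for all $n\ge 0$ with some Borel probability measure $\mu$ on $[0,1]$. Let $\Lambda=\mathbb{C}\setminus[1,+\infty)$, and let $\mathcal{T}$ be the set of analytic functions $F$ on $\Lambda$ for which there is a normalized Hausdorff moment sequence $(a_n)$ with $F(z)=\sum_{n=0}^\infty a_n z^n$ for $|z|<1$. Let $\widetilde{\mathcal{T}}$ be the set of the functions $z\mapsto zF(z)$ on $\Lambda$ with $F\in\mathcal{T}$, and for $0\le c<1$ let $\mathcal{HT}(c)$ be the set of functions $f=h+c\,\overline{g}$ on $\Lambda$ with $h,g\in\widetilde{\mathcal{T}}$. Let $0\le c<1$, let $f\in\mathcal{HT}(c)$, and let $H=\{z\in\mathbb{C}:\operatorname{Re} z<1\}$. Suppose that $f$ is locally univalent on $H$, that is, every point of $H$ has a neighbourhood on which $f$ is injective. Then $f$ is univalent on $H$, that is, $f$ is injective on $H$ and sense-preserving there, in the sense that its Jacobian $J_f=|f_z|^2-|f_{\bar z}|^2$ is positive at every point of $H$. Moreover, $f(H)$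 is a domain that is convex in the direction of the imaginary axis: it is non-empty, open and connected, and its intersection with every line parallel to the imaginary axis is connected or empty. -/

import Mathlib

open MeasureTheory Set Topology

namespace HausdorffHarmonic

/-- The slit domain `ℂ \ [1, +∞)`. -/
def slitDomain : Set ℂ := {z : ℂ | ¬ (1 ≤ z.re ∧ z.im = 0)}

/-- The half-plane `{z : Re z < 1}`. -/
def halfPlane : Set ℂ := {z : ℂ | z.re < 1}

/-- `a` is a Hausdorff moment sequence: `a n = ∫ tⁿ dμ(t)` for some finite positive Borel
measure `μ` on `[0, 1]`. -/
def IsHausdorffMomentSeq (a : ℕ → ℝ) : Prop :=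
  ∃ μ : Measure unitInterval, IsFiniteMeasure μ ∧ ∀ n : ℕ, a n = ∫ t, (t : ℝ) ^ n ∂μ

/-- The class `𝒯`: the analytic functions on `ℂ \ [1, +∞)` whose power series on the unit disk
is the generating function of a normalized (`a 0 = 1`) Hausdorff moment sequence.
The values off the slit domain are irrelevant. -/
def classT : Set (ℂ → ℂ) :=
  {F | DifferentiableOn ℂ F slitDomain ∧
    ∃ a : ℕ → ℝ, IsHausdorffMomentSeq a ∧ a 0 = 1 ∧
      ∀ z : ℂ, ‖z‖ < 1 → HasSum (fun n : ℕ => (a n : ℂ) * z ^ n) (F z)}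

/-- The class of shifted generating functions `z ↦ z F(z)` with `F ∈ 𝒯`. -/
def shiftedT : Set (ℂ → ℂ) :=
  {h | ∃ F ∈ classT, ∀ z ∈ slitDomain, h z = z * F z}

/-- The class `ℋ𝒯(c)` of functions `f = h + c * conj g` on `ℂ \ [1, +∞)` with `h` and `g`
shifted generating functions. -/
def classHT (c : ℂ) : Set (ℂ → ℂ) :=
  {f | ∃ h ∈ shiftedT, ∃ g ∈ shiftedT,
    ∀ z ∈ slitDomain, f z = h z + c * (starRingEnd ℂ) (g z)}

/-- The Wirtinger derivative `f_z = (f_x - i f_y) / 2`. -/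
noncomputable def dz (f : ℂ → ℂ) (z : ℂ) : ℂ :=
  (fderiv ℝ f z 1 - Complex.I * fderiv ℝ f z Complex.I) / 2

/-- The Wirtinger derivative `f_{z̄} = (f_x + i f_y) / 2`. -/
noncomputable def dzbar (f : ℂ → ℂ) (z : ℂ) : ℂ :=
  (fderiv ℝ f z 1 + Complex.I * fderiv ℝ f z Complex.I) / 2

/-- The Jacobian `|f_z|² - |f_{z̄}|²`. At a point where `f` is not real differentiable this is
`0`, so that positivity of the Jacobian includes differentiability. -/
noncomputable def jacobian (f : ℂ → ℂ) (z : ℂ) : ℝ :=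
  ‖dz f z‖ ^ 2 - ‖dzbar f z‖ ^ 2

/-- `f` is locally univalent on `U`: each point of `U` has a neighbourhood on which `f` is
one-to-one. -/
def LocallyUnivalentOn (f : ℂ → ℂ) (U : Set ℂ) : Prop :=
  ∀ z ∈ U, ∃ V ∈ 𝓝 z, InjOn f V

/-- `f` is univalent on `U`: it is one-to-one and sense-preserving there, the latter in the
strong sense that the Jacobian is positive. -/
def UnivalentOn (f : ℂ → ℂ) (U : Set ℂ) : Prop :=
  InjOn f U ∧ ∀ z ∈ U, 0 < jacobian f z

/-- `D` is a domain (a nonempty connected open set) that is convex in the direction of the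
imaginary axis: each vertical line meets `D` in a connected or empty set. -/
def ConvexInImaginaryDirection (D : Set ℂ) : Prop :=
  IsOpen D ∧ IsConnected D ∧ ∀ x : ℝ, IsPreconnected (D ∩ {w : ℂ | w.re = x})

end HausdorffHarmonic

/-!
The theorem is a shear argument whose base is a conformal map that is convex in the vertical
direction.

A shifted generating function has the form `∫ z / (1 - t z) dμ(t)` on the half-plane
(`exists_eqOn_stieltjes`). Put `u = 1 - z` and `s = 1 - t`. Since
`u / (s + t u)² = 1 / (s² / u + 2 s t + t² u)` has positive real part for `Re u > 0`, every such
function satisfies `Re ((1 - z) h' z) > 0`; so does `φ = h + c g`. In the coordinate `log (1 - z)`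
on a strip this is the Noshiro–Warschawski condition, so `φ` is univalent
(`RayDecreasing.injOn`), and it says that `Re φ` decreases along each ray `z = 1 - r (1 + m i)`.
The elementary inequalities `Re φ (1 - r (1 + m²)) ≤ Re φ (1 - r (1 + m i)) ≤ Re φ (1 - r)` show
that `Re φ` has the same range along all rays. A level set of `Re φ` is therefore empty or a
continuous graph over all slopes `m` (`RayDecreasing.isPreconnected_level`); no boundary behaviour
of `φ` is needed.

Since `Re f = Re φ` and `Im f = Im (h - c g)`, the map `f ∘ φ⁻¹` on `φ(H)` is
`w ↦ Re w + i Im G w` with `G = (h - c g) ∘ φ⁻¹` holomorphic, and its Jacobian is `Re G'`. Such a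
map can only be locally injective where `Re G' ≠ 0` (`re_deriv_ne_zero_of_injOn`, a case of
Lewy's theorem). As `Re G'` is positive at the image of `0`, it is positive throughout, so `Im G`
increases along the connected vertical slices of `φ(H)` and `f` is injective (`injOn_shear`).
The vertical slices of `f(H)` are the images of the level sets of `Re φ`, and `f(H)` is open by the
inverse function theorem.
-/

namespace HausdorffHarmonic

/-! ### The half-plane and the positivity of the kernel derivative -/

lemma isOpen_halfPlane : IsOpen halfPlane := isOpen_lt Complex.continuous_re continuous_const

lemma convex_halfPlane : Convex ℝ halfPlane := convex_halfSpace_re_lt 1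

lemma zero_mem_halfPlane : (0 : ℂ) ∈ halfPlane := by simp [halfPlane]

lemma halfPlane_subset_slitDomain : halfPlane ⊆ slitDomain := fun _ hz h =>
  absurd h.1 (not_le.2 hz)

lemma min_le_re_one_sub_mul {t : ℝ} (ht0 : 0 ≤ t) (ht1 : t ≤ 1) (z : ℂ) :
    min 1 (1 - z.re) ≤ (1 - (t : ℂ) * z).re := by
  have : (1 - (t : ℂ) * z).re = (1 - t) * 1 + t * (1 - z.re) := by simp; ring
  rw [this]
  have h1 := mul_le_mul_of_nonneg_left (min_le_left 1 (1 - z.re)) (sub_nonneg.2 ht1)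
  have h2 := mul_le_mul_of_nonneg_left (min_le_right 1 (1 - z.re)) ht0
  linarith

lemma re_one_sub_mul_pos {t : ℝ} (ht0 : 0 ≤ t) (ht1 : t ≤ 1) {z : ℂ} (hz : z.re < 1) :
    0 < (1 - (t : ℂ) * z).re :=
  (lt_min one_pos (sub_pos.2 hz)).trans_le (min_le_re_one_sub_mul ht0 ht1 z)

lemma one_sub_mul_ne_zero {t : ℝ} (ht0 : 0 ≤ t) (ht1 : t ≤ 1) {z : ℂ} (hz : z.re < 1) :
    1 - (t : ℂ) * z ≠ 0 := fun h => by
  have := re_one_sub_mul_pos ht0 ht1 hz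
  simp [h] at this

/-- With `u = 1 - z` and `s = 1 - t` this reads `Re (u / (s + t u)²) > 0` for `Re u > 0`; the
reciprocal is `s² / u + 2 s t + t² u`. -/
lemma re_mul_kernel_deriv_pos {t : ℝ} (ht0 : 0 ≤ t) (ht1 : t ≤ 1) {z : ℂ} (hz : z.re < 1) :
    0 < ((1 - z) * (1 / (1 - (t : ℂ) * z) ^ 2)).re := by
  set u : ℂ := 1 - z with hu
  have hure : 0 < u.re := by simp [hu, hz]
  have hd := one_sub_mul_ne_zero ht0 ht1 hz
  set d : ℂ := 1 - (t : ℂ) * z with hdd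
  have hdu : d = ((1 - t : ℝ) : ℂ) + t * u := by rw [hdd, hu]; push_cast; ring
  have hn : 0 < Complex.normSq d := Complex.normSq_pos.2 hd
  have key : u * (1 / d ^ 2) =
      (((Complex.normSq d ^ 2)⁻¹ : ℝ) : ℂ) * (u * (starRingEnd ℂ d) ^ 2) := by
    have : (starRingEnd ℂ d) ≠ 0 := by simpa using hd
    push_cast
    rw [← Complex.mul_conj]
    field_simp
  rw [key, Complex.re_ofReal_mul]
  refine mul_pos (by positivity) ?_
  have : (u * (starRingEnd ℂ d) ^ 2).re =
      ((1 - t) ^ 2 + t ^ 2 * (u.re ^ 2 + u.im ^ 2)) * u.re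
        + 2 * (1 - t) * t * (u.re ^ 2 + u.im ^ 2) := by
    rw [hdu]; simp [pow_two]; ring
  rw [this]
  have h3 : 0 ≤ 2 * (1 - t) * t * (u.re ^ 2 + u.im ^ 2) :=
    mul_nonneg (mul_nonneg (by linarith) ht0) (by positivity)
  have h4 : 0 < (1 - t) ^ 2 + t ^ 2 * (u.re ^ 2 + u.im ^ 2) := by
    rcases ht0.eq_or_lt with rfl | h
    · norm_num
    · have : 0 < u.re ^ 2 + u.im ^ 2 := by positivity
      positivity
  have := mul_pos h4 hure
  linarith

/-! ### The integral kernel on rays through `1` -/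

lemma re_ray {r m : ℝ} : ((1 : ℂ) - r * (1 + m * Complex.I)).re = 1 - r := by simp

lemma ray_mem_halfPlane {r m : ℝ} (hr : 0 < r) :
    (1 : ℂ) - r * (1 + m * Complex.I) ∈ halfPlane := by
  simp only [halfPlane, mem_ofPred_eq, re_ray]; linarith

lemma re_kernel_ray (t r m : ℝ) :
    (((1 : ℂ) - r * (1 + m * Complex.I)) / (1 - (t : ℂ) * (1 - r * (1 + m * Complex.I)))).re =
      ((1 - r) * (1 - t + t * r) - t * r ^ 2 * m ^ 2) /
        ((1 - t + t * r) ^ 2 + (t * r * m) ^ 2) := by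
  rw [Complex.div_re, ← add_div]
  congr 1
  · simp; ring
  · simp [Complex.normSq_apply]; ring

/-- With `s = 1 - t` and `u = r (1 + m i)`, the kernel is `(1 / (s + t u) - 1) / t` for `t ≠ 0`, and
`Re (1 / v) ≤ 1 / Re v`. -/
lemma re_kernel_ray_le {t r : ℝ} (m : ℝ) (ht0 : 0 ≤ t) (ht1 : t ≤ 1) (hr : 0 < r) :
    (((1 : ℂ) - r * (1 + m * Complex.I)) / (1 - (t : ℂ) * (1 - r * (1 + m * Complex.I)))).re ≤
    (((1 : ℂ) - r * (1 + (0 : ℝ) * Complex.I)) /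
      (1 - (t : ℂ) * (1 - r * (1 + (0 : ℝ) * Complex.I)))).re := by
  rw [re_kernel_ray, re_kernel_ray]
  have hA : 0 < 1 - t + t * r := by
    rcases ht0.eq_or_lt with rfl | h
    · norm_num
    · nlinarith [mul_pos h hr]
  set A := 1 - t + t * r with hAdef
  rw [div_le_div_iff₀ (by positivity) (by positivity)]
  have : 0 ≤ t * r ^ 2 * m ^ 2 * A * (A + t * (1 - r)) := by
    have : A + t * (1 - r) = 1 := by rw [hAdef]; ring
    rw [this]; positivity
  nlinarith [this]

/-- The point `r (1 + m²)` of the real ray is `|u|² / Re u` for `u = r (1 + m i)`; it is chosen so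
that the comparison holds for every `t`. -/
lemma le_re_kernel_ray {t r : ℝ} (m : ℝ) (ht0 : 0 ≤ t) (ht1 : t ≤ 1) (hr : 0 < r) :
    (((1 : ℂ) - (r * (1 + m ^ 2) : ℝ) * (1 + (0 : ℝ) * Complex.I)) /
      (1 - (t : ℂ) * (1 - (r * (1 + m ^ 2) : ℝ) * (1 + (0 : ℝ) * Complex.I)))).re ≤
    (((1 : ℂ) - r * (1 + m * Complex.I)) / (1 - (t : ℂ) * (1 - r * (1 + m * Complex.I)))).re := by
  have hr' : 0 < r * (1 + m ^ 2) := by positivity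
  rw [re_kernel_ray, re_kernel_ray]
  have hA : 0 < 1 - t + t * r := by
    rcases ht0.eq_or_lt with rfl | h
    · norm_num
    · nlinarith [mul_pos h hr]
  have hB : 0 < 1 - t + t * (r * (1 + m ^ 2)) := by
    have : 0 ≤ t * (r * m ^ 2) := by positivity
    nlinarith
  have e : ∀ R B : ℝ, B ≠ 0 →
      ((1 - R) * B - t * R ^ 2 * 0 ^ 2) / (B ^ 2 + (t * R * 0) ^ 2) = (1 - R) / B := by
    intro R B hB
    field_simp
    ring
  rw [e _ _ hB.ne', div_le_div_iff₀ hB (by positivity)]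
  have h : ((1 - r) * (1 - t + t * r) - t * r ^ 2 * m ^ 2) * (1 - t + t * (r * (1 + m ^ 2))) -
      (1 - r * (1 + m ^ 2)) * ((1 - t + t * r) ^ 2 + (t * r * m) ^ 2) =
      (1 - t) * r * m ^ 2 := by ring
  have : 0 ≤ (1 - t) * r * m ^ 2 :=
    mul_nonneg (mul_nonneg (by linarith) hr.le) (sq_nonneg m)
  linarith

/-! ### Integrals of the kernel -/

section Stieltjes

/-- The shifted generating function `z ↦ ∫ z / (1 - t z) dμ(t)` of the moments of `μ`. -/
noncomputable def stieltjes (μ : Measure unitInterval) (z : ℂ) : ℂ :=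
  ∫ t : unitInterval, z / (1 - ((t : ℝ) : ℂ) * z) ∂μ

variable (μ : Measure unitInterval)

lemma continuous_kernel {z : ℂ} (hz : z ∈ halfPlane) :
    Continuous fun t : unitInterval => z / (1 - ((t : ℝ) : ℂ) * z) := by
  refine Continuous.div continuous_const (by fun_prop) fun t => ?_
  exact one_sub_mul_ne_zero t.2.1 t.2.2 hz

lemma continuous_kernel_deriv {z : ℂ} (hz : z ∈ halfPlane) :
    Continuous fun t : unitInterval => 1 / (1 - ((t : ℝ) : ℂ) * z) ^ 2 := by
  refine Continuous.div continuous_const (by fun_prop) fun t => ?_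
  exact pow_ne_zero 2 (one_sub_mul_ne_zero t.2.1 t.2.2 hz)

lemma integrable_of_continuous [IsFiniteMeasure μ] {E : Type*} [NormedAddCommGroup E]
    {k : unitInterval → E} (hk : Continuous k) : Integrable k μ :=
  hk.integrable_of_hasCompactSupport (HasCompactSupport.of_compactSpace _)

lemma hasDerivAt_stieltjes [IsFiniteMeasure μ] {z : ℂ} (hz : z ∈ halfPlane) :
    HasDerivAt (stieltjes μ) (∫ t : unitInterval, 1 / (1 - ((t : ℝ) : ℂ) * z) ^ 2 ∂μ) z := by
  have hz' : 0 < 1 - z.re := sub_pos.2 hz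
  set ε := (1 - z.re) / 2 with hε
  set δ := min 1 ε with hδ
  have hε0 : 0 < ε := by positivity
  have hδ0 : 0 < δ := lt_min one_pos hε0
  have hball : ∀ w ∈ Metric.ball z ε, ε ≤ 1 - w.re := fun w hw => by
    have h1 := (abs_le.1 (Complex.abs_re_le_norm (w - z))).2
    rw [mem_ball_iff_norm] at hw
    simp only [Complex.sub_re] at h1
    linarith
  have hmem : ∀ w ∈ Metric.ball z ε, w ∈ halfPlane := fun w hw => by
    have := hball w hw
    show w.re < 1
    linarith
  refine (hasDerivAt_integral_of_dominated_loc_of_deriv_le (μ := μ)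
    (F := fun w (t : unitInterval) => w / (1 - ((t : ℝ) : ℂ) * w))
    (F' := fun w (t : unitInterval) => 1 / (1 - ((t : ℝ) : ℂ) * w) ^ 2)
    (bound := fun _ => 1 / δ ^ 2) (Metric.ball_mem_nhds z hε0) ?_ ?_ ?_ ?_ ?_ ?_).2
  · filter_upwards [isOpen_halfPlane.mem_nhds hz] with w hw
    exact (integrable_of_continuous μ (continuous_kernel hw)).aestronglyMeasurable
  · exact integrable_of_continuous μ (continuous_kernel hz)
  · exact (integrable_of_continuous μ (continuous_kernel_deriv hz)).aestronglyMeasurable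
  · refine Filter.Eventually.of_forall fun t w hw => ?_
    have h1 : δ ≤ ‖1 - ((t : ℝ) : ℂ) * w‖ :=
      ((min_le_min_left 1 (hball w hw)).trans (min_le_re_one_sub_mul t.2.1 t.2.2 w)).trans
        (Complex.re_le_norm _)
    rw [norm_div, norm_one, norm_pow]
    gcongr
  · exact integrable_const _
  · refine Filter.Eventually.of_forall fun t w hw => ?_
    have hne := one_sub_mul_ne_zero t.2.1 t.2.2 (hmem w hw)
    have h1 : HasDerivAt (fun w : ℂ => 1 - ((t : ℝ) : ℂ) * w) (-((t : ℝ) : ℂ)) w := by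
      simpa using ((hasDerivAt_id w).const_mul ((t : ℝ) : ℂ)).const_sub 1
    exact ((hasDerivAt_id w).div h1 hne).congr_deriv
      (by congr 1; simp only [id]; ring)

lemma differentiableOn_stieltjes [IsFiniteMeasure μ] :
    DifferentiableOn ℂ (stieltjes μ) halfPlane := fun _ hz =>
  (hasDerivAt_stieltjes μ hz).differentiableAt.differentiableWithinAt

lemma deriv_stieltjes_zero [IsProbabilityMeasure μ] : deriv (stieltjes μ) 0 = 1 := by
  rw [(hasDerivAt_stieltjes μ zero_mem_halfPlane).deriv]; simp

lemma re_integral [IsFiniteMeasure μ] {k : unitInterval → ℂ} (hk : Continuous k) :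
    (∫ t, k t ∂μ).re = ∫ t, (k t).re ∂μ :=
  (Complex.reCLM.integral_comp_comm (integrable_of_continuous μ hk)).symm

/-- A holomorphic function `φ` on the half-plane whose real part decreases along each ray
`r ↦ 1 - r (1 + m i)`, and is comparable along that ray with its values on the real ray. The
derivative of `r ↦ Re φ (1 - r (1 + m i))` is `-Re ((1 - z) φ' z) / r`. -/
structure RayDecreasing (φ : ℂ → ℂ) : Prop where
  differentiableOn : DifferentiableOn ℂ φ halfPlane
  re_pos : ∀ z ∈ halfPlane, 0 < ((1 - z) * deriv φ z).re
  le_real : ∀ r m : ℝ, 0 < r → (φ (1 - r * (1 + m * Complex.I))).re ≤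
    (φ (1 - r * (1 + (0 : ℝ) * Complex.I))).re
  real_le : ∀ r m : ℝ, 0 < r → (φ (1 - (r * (1 + m ^ 2) : ℝ) * (1 + (0 : ℝ) * Complex.I))).re ≤
    (φ (1 - r * (1 + m * Complex.I))).re

lemma rayDecreasing_stieltjes [IsProbabilityMeasure μ] : RayDecreasing (stieltjes μ) where
  differentiableOn := differentiableOn_stieltjes μ
  re_pos z hz := by
    have hc : Continuous fun t : unitInterval =>
        (1 - z) * (1 / (1 - ((t : ℝ) : ℂ) * z) ^ 2) :=
      continuous_const.mul (continuous_kernel_deriv hz)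
    rw [(hasDerivAt_stieltjes μ hz).deriv, ← integral_const_mul, re_integral μ hc,
      integral_pos_iff_support_of_nonneg
        (fun t => (re_mul_kernel_deriv_pos t.2.1 t.2.2 hz).le)
        (integrable_of_continuous μ (Complex.continuous_re.comp hc))]
    have : Function.support (fun t : unitInterval =>
        ((1 - z) * (1 / (1 - ((t : ℝ) : ℂ) * z) ^ 2)).re) = univ :=
      eq_univ_of_forall fun t => (re_mul_kernel_deriv_pos t.2.1 t.2.2 hz).ne'
    rw [this, measure_univ]
    exact one_pos
  le_real r m hr := by
    have h1 := continuous_kernel (ray_mem_halfPlane (m := m) hr)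
    have h2 := continuous_kernel (ray_mem_halfPlane (m := 0) hr)
    rw [stieltjes, stieltjes, re_integral μ h1, re_integral μ h2]
    exact integral_mono (integrable_of_continuous μ (Complex.continuous_re.comp h1))
      (integrable_of_continuous μ (Complex.continuous_re.comp h2))
      fun t => re_kernel_ray_le m t.2.1 t.2.2 hr
  real_le r m hr := by
    have h1 := continuous_kernel (ray_mem_halfPlane (m := m) hr)
    have hr' : 0 < r * (1 + m ^ 2) := by positivity
    have h2 := continuous_kernel (ray_mem_halfPlane (m := 0) hr')
    rw [stieltjes, stieltjes, re_integral μ h1, re_integral μ h2]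
    exact integral_mono (integrable_of_continuous μ (Complex.continuous_re.comp h2))
      (integrable_of_continuous μ (Complex.continuous_re.comp h1))
      fun t => le_re_kernel_ray m t.2.1 t.2.2 hr

lemma RayDecreasing.add_const_mul {h g : ℂ → ℂ} (hh : RayDecreasing h) (hg : RayDecreasing g)
    {c : ℝ} (hc : 0 ≤ c) : RayDecreasing fun z => h z + c * g z where
  differentiableOn := hh.differentiableOn.add (hg.differentiableOn.const_mul _)
  re_pos z hz := by
    have dh := hh.differentiableOn.differentiableAt (isOpen_halfPlane.mem_nhds hz)
    have dg := hg.differentiableOn.differentiableAt (isOpen_halfPlane.mem_nhds hz)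
    have hd : deriv (fun z => h z + c * g z) z = deriv h z + c * deriv g z :=
      (dh.hasDerivAt.add (dg.hasDerivAt.const_mul (c : ℂ))).deriv
    rw [hd]
    have : (1 - z) * (deriv h z + c * deriv g z) =
        (1 - z) * deriv h z + c * ((1 - z) * deriv g z) := by ring
    rw [this, Complex.add_re, Complex.re_ofReal_mul]
    exact add_pos_of_pos_of_nonneg (hh.re_pos z hz) (mul_nonneg hc (hg.re_pos z hz).le)
  le_real r m hr := by
    simp only [Complex.add_re, Complex.re_ofReal_mul]
    exact add_le_add (hh.le_real r m hr) (mul_le_mul_of_nonneg_left (hg.le_real r m hr) hc)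
  real_le r m hr := by
    simp only [Complex.add_re, Complex.re_ofReal_mul]
    exact add_le_add (hh.real_le r m hr) (mul_le_mul_of_nonneg_left (hg.real_le r m hr) hc)

lemma hasSum_integral_one_div [IsFiniteMeasure μ] {z : ℂ} (hz : ‖z‖ < 1) :
    HasSum (fun n : ℕ => ((∫ t : unitInterval, (t : ℝ) ^ n ∂μ : ℝ) : ℂ) * z ^ n)
      (∫ t : unitInterval, 1 / (1 - ((t : ℝ) : ℂ) * z) ∂μ) := by
  have hterm : ∀ n : ℕ, ((∫ t : unitInterval, (t : ℝ) ^ n ∂μ : ℝ) : ℂ) * z ^ n =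
      ∫ t : unitInterval, (((t : ℝ) : ℂ) * z) ^ n ∂μ := fun n => by
    rw [← integral_complex_ofReal, ← integral_mul_const]
    simp [mul_pow]
  simp only [hterm]
  have hle : ∀ t : unitInterval, ‖((t : ℝ) : ℂ) * z‖ ≤ ‖z‖ := fun t => by
    rw [norm_mul, Complex.norm_real, Real.norm_of_nonneg t.2.1]
    exact mul_le_of_le_one_left (norm_nonneg _) t.2.2
  refine hasSum_integral_of_dominated_convergence (fun n _ => ‖z‖ ^ n) (fun n => ?_)
    (fun n => ?_) ?_ ?_ ?_
  · exact (integrable_of_continuous μ (by fun_prop)).aestronglyMeasurable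
  · refine Filter.Eventually.of_forall fun t => ?_
    rw [norm_pow]
    exact pow_le_pow_left₀ (norm_nonneg _) (hle t) n
  · exact Filter.Eventually.of_forall fun _ => summable_geometric_of_lt_one (norm_nonneg _) hz
  · exact integrable_const _
  · refine Filter.Eventually.of_forall fun t => ?_
    rw [one_div]
    exact hasSum_geometric_of_norm_lt_one ((hle t).trans_lt hz)

/-- By the identity theorem, a shifted generating function is given on the half-plane by the
integral that represents it on the unit disk. -/
lemma exists_eqOn_stieltjes {h : ℂ → ℂ} (hh : h ∈ shiftedT) :
    ∃ μ : Measure unitInterval, IsProbabilityMeasure μ ∧ EqOn h (stieltjes μ) halfPlane := by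
  obtain ⟨F, ⟨hF, a, ⟨μ, hμ, ha⟩, ha0, hsum⟩, hhF⟩ := hh
  have hprob : IsProbabilityMeasure μ := by
    have h0 := ha 0
    simp only [pow_zero, integral_const, smul_eq_mul, mul_one, ha0] at h0
    constructor
    rw [← ENNReal.ofReal_toReal (measure_ne_top μ univ)]
    have : (μ univ).toReal = 1 := h0.symm
    simp [this]
  refine ⟨μ, hprob, ?_⟩
  have h1 : DifferentiableOn ℂ h halfPlane :=
    ((differentiableOn_id.mul (hF.mono halfPlane_subset_slitDomain))).congr
      fun z hz => hhF z (halfPlane_subset_slitDomain hz)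
  refine (h1.analyticOnNhd isOpen_halfPlane).eqOn_of_preconnected_of_eventuallyEq
    ((differentiableOn_stieltjes μ).analyticOnNhd isOpen_halfPlane)
    convex_halfPlane.isPreconnected zero_mem_halfPlane ?_
  filter_upwards [Metric.ball_mem_nhds (0 : ℂ) one_pos,
    isOpen_halfPlane.mem_nhds zero_mem_halfPlane] with z hz hz'
  have hz1 : ‖z‖ < 1 := by simpa using hz
  have hs := hsum z hz1
  simp only [ha] at hs
  rw [hhF z (halfPlane_subset_slitDomain hz'), hs.unique (hasSum_integral_one_div μ hz1),
    stieltjes, ← integral_const_mul]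
  simp [div_eq_mul_inv]

end Stieltjes

/-! ### Level sets of the real part and univalence -/

lemma hasDerivAt_comp_line {φ : ℂ → ℂ} {a b : ℂ} {t : ℝ}
    (h : DifferentiableAt ℂ φ (a + t * b)) :
    HasDerivAt (fun s : ℝ => φ (a + s * b)) (deriv φ (a + t * b) * b) t := by
  have h1 : HasDerivAt (fun s : ℝ => a + (s : ℂ) * b) b t := by
    simpa using ((Complex.ofRealCLM.hasDerivAt (x := t)).mul_const b).const_add a
  exact h.hasDerivAt.comp t h1

/-- The Noshiro–Warschawski criterion. -/
lemma injOn_of_re_deriv_neg {Φ : ℂ → ℂ} {S : Set ℂ} (hS : Convex ℝ S)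
    (hd : ∀ z ∈ S, DifferentiableAt ℂ Φ z) (hneg : ∀ z ∈ S, (deriv Φ z).re < 0) :
    InjOn Φ S := by
  intro z₁ h₁ z₂ h₂ heq
  by_contra hne
  have hb : z₂ - z₁ ≠ 0 := sub_ne_zero.2 (Ne.symm hne)
  have hmem : ∀ t ∈ Icc (0 : ℝ) 1, z₁ + (t : ℂ) * (z₂ - z₁) ∈ S := fun t ht => by
    simpa using hS.add_smul_sub_mem h₁ h₂ ht
  have hder : ∀ t ∈ Icc (0 : ℝ) 1,
      HasDerivAt (fun s : ℝ => (Φ (z₁ + s * (z₂ - z₁)) * (z₂ - z₁)⁻¹).re)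
        (deriv Φ (z₁ + t * (z₂ - z₁))).re t := fun t ht => by
    have h := (hasDerivAt_comp_line (hd _ (hmem t ht))).mul_const (z₂ - z₁)⁻¹
    rw [mul_inv_cancel_right₀ hb] at h
    exact Complex.reCLM.hasFDerivAt.comp_hasDerivAt t h
  obtain ⟨t, ht, hslope⟩ := exists_hasDerivAt_eq_slope _ _ one_pos
    (fun t ht => (hder t ht).continuousAt.continuousWithinAt)
    fun t ht => hder t (Ioo_subset_Icc_self ht)
  have := hneg _ (hmem t (Ioo_subset_Icc_self ht))
  simp [heq] at hslope
  linarith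

namespace RayDecreasing

variable {φ : ℂ → ℂ}

lemma differentiableAt (hφ : RayDecreasing φ) {z : ℂ} (hz : z ∈ halfPlane) :
    DifferentiableAt ℂ φ z :=
  hφ.differentiableOn.differentiableAt (isOpen_halfPlane.mem_nhds hz)

lemma deriv_ne_zero (hφ : RayDecreasing φ) {z : ℂ} (hz : z ∈ halfPlane) : deriv φ z ≠ 0 :=
  fun h => by simpa [h] using hφ.re_pos z hz

/-- In the coordinate `ζ = log (1 - z)`, which maps the half-plane onto a strip, the derivative
of `φ` is `-(1 - z) φ' z`, so that the Noshiro–Warschawski criterion applies. -/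
lemma injOn (hφ : RayDecreasing φ) : InjOn φ halfPlane := by
  set S : Set ℂ := {ζ | ζ.im ∈ Ioo (-(Real.pi / 2)) (Real.pi / 2)}
  have hS : Convex ℝ S := (convex_Ioo _ _).linear_preimage Complex.imLm
  have hmem : ∀ ζ ∈ S, 1 - Complex.exp ζ ∈ halfPlane := fun ζ hζ => by
    have : 0 < (Complex.exp ζ).re := by
      rw [Complex.exp_re]
      exact mul_pos (Real.exp_pos _) (Real.cos_pos_of_mem_Ioo hζ)
    show (1 - Complex.exp ζ).re < 1
    simpa using this
  have hder : ∀ ζ ∈ S, HasDerivAt (fun ζ => φ (1 - Complex.exp ζ))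
      (deriv φ (1 - Complex.exp ζ) * -Complex.exp ζ) ζ := fun ζ hζ =>
    (hφ.differentiableAt (hmem ζ hζ)).hasDerivAt.comp ζ ((Complex.hasDerivAt_exp ζ).const_sub 1)
  have hinj := injOn_of_re_deriv_neg hS (fun ζ hζ => (hder ζ hζ).differentiableAt)
    fun ζ hζ => by
      rw [(hder ζ hζ).deriv]
      have := hφ.re_pos _ (hmem ζ hζ)
      rw [sub_sub_cancel, mul_comm] at this
      rw [mul_neg, Complex.neg_re]
      linarith
  have hlog : ∀ z ∈ halfPlane, Complex.log (1 - z) ∈ S ∧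
      1 - Complex.exp (Complex.log (1 - z)) = z := fun z hz => by
    have hz' : 0 < (1 - z).re := by simpa using (show z.re < 1 from hz)
    have h0 : 1 - z ≠ 0 := fun h => by simp [h] at hz'
    refine ⟨?_, by rw [Complex.exp_log h0]; ring⟩
    have := Complex.abs_arg_lt_pi_div_two_iff.2 (Or.inl hz')
    rw [← Complex.log_im] at this
    exact abs_lt.1 this
  intro z₁ h₁ z₂ h₂ heq
  have := hinj (hlog z₁ h₁).1 (hlog z₂ h₂).1
    (by simpa only [(hlog z₁ h₁).2, (hlog z₂ h₂).2] using heq)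
  rw [← (hlog z₁ h₁).2, ← (hlog z₂ h₂).2, this]

/-- Differentiating along the ray gives `-Re ((1 - z) φ' z) / r`. -/
lemma strictAntiOn (hφ : RayDecreasing φ) (m : ℝ) :
    StrictAntiOn (fun r : ℝ => (φ (1 - r * (1 + m * Complex.I))).re) (Ioi 0) := by
  have hder : ∀ r ∈ Ioi (0 : ℝ), HasDerivAt
      (fun r : ℝ => (φ (1 - r * (1 + m * Complex.I))).re)
      (deriv φ (1 - r * (1 + m * Complex.I)) * -(1 + m * Complex.I)).re r := fun r hr => by
    have hz := hφ.differentiableAt (ray_mem_halfPlane (m := m) hr)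
    simp only [sub_eq_add_neg, ← mul_neg] at hz ⊢
    exact Complex.reCLM.hasFDerivAt.comp_hasDerivAt r (hasDerivAt_comp_line hz)
  refine strictAntiOn_of_deriv_neg (convex_Ioi 0)
    (fun r hr => (hder r hr).continuousAt.continuousWithinAt) fun r hr => ?_
  rw [interior_Ioi] at hr
  rw [(hder r hr).deriv]
  have h := hφ.re_pos _ (ray_mem_halfPlane (m := m) hr)
  rw [sub_sub_cancel, mul_assoc, Complex.re_ofReal_mul] at h
  have := pos_of_mul_pos_right h (le_of_lt hr)
  rw [mul_comm] at this
  rw [mul_neg, Complex.neg_re]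
  linarith

lemma continuous_slope (hφ : RayDecreasing φ) {r : ℝ} (hr : 0 < r) :
    Continuous fun m : ℝ => (φ (1 - r * (1 + m * Complex.I))).re :=
  Complex.continuous_re.comp <| hφ.differentiableOn.continuousOn.comp_continuous (by fun_prop)
    fun _ => ray_mem_halfPlane hr

lemma continuousOn_ray (hφ : RayDecreasing φ) (m : ℝ) :
    ContinuousOn (fun r : ℝ => (φ (1 - r * (1 + m * Complex.I))).re) (Ioi 0) :=
  Complex.continuous_re.comp_continuousOn <| hφ.differentiableOn.continuousOn.comp
    (by fun_prop) fun _ hr => ray_mem_halfPlane hr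

/-- By the comparison with the real ray, `Re φ` has the same range along all rays. -/
lemma exists_eq_of_eq (hφ : RayDecreasing φ) {r m x : ℝ} (hr : 0 < r)
    (hx : (φ (1 - r * (1 + m * Complex.I))).re = x) (m' : ℝ) :
    ∃ r' : ℝ, 0 < r' ∧ (φ (1 - r' * (1 + m' * Complex.I))).re = x := by
  have hle : ∀ {s n : ℝ}, 0 < s → s ≤ s * (1 + n ^ 2) := fun {s n} hs => by
    nlinarith [mul_nonneg hs.le (sq_nonneg n)]
  -- `x` is a value on the real ray, attained at `s`
  obtain ⟨s, hs, hsx⟩ : x ∈ (fun r : ℝ => (φ (1 - r * (1 + (0 : ℝ) * Complex.I))).re) ''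
      Icc r (r * (1 + m ^ 2)) :=
    intermediate_value_Icc' (hle hr)
      ((hφ.continuousOn_ray 0).mono fun s hs => hr.trans_le hs.1)
      ⟨hx ▸ hφ.real_le r m hr, hx ▸ hφ.le_real r m hr⟩
  have hs0 : 0 < s := hr.trans_le hs.1
  have hs1 : 0 < s / (1 + m' ^ 2) := by positivity
  have hcancel : s / (1 + m' ^ 2) * (1 + m' ^ 2) = s := by
    field_simp
  -- on the ray of slope `m'`, the values at `s / (1 + m'²)` and `s` enclose `x`
  have h1 := hφ.real_le _ m' hs1
  have h2 := hφ.le_real s m' hs0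
  have h3 := hle (n := m') hs1
  rw [hcancel] at h1 h3
  obtain ⟨r', hr', hrx⟩ := intermediate_value_Icc' h3
      ((hφ.continuousOn_ray m').mono fun t ht => hs1.trans_le ht.1)
      (show x ∈ _ from ⟨h2.trans hsx.le, hsx.ge.trans h1⟩)
  exact ⟨r', hs1.trans_le hr'.1, hrx⟩

/-- A level set of `Re φ` is empty or a curve `r = ρ m` with `ρ` continuous. -/
lemma isPreconnected_level (hφ : RayDecreasing φ) (x : ℝ) :
    IsPreconnected {z | z ∈ halfPlane ∧ (φ z).re = x} := by
  have hray : ∀ z ∈ halfPlane,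
      z = 1 - ((1 - z.re : ℝ) : ℂ) * (1 + (-z.im / (1 - z.re) : ℝ) * Complex.I) := fun z hz => by
    have : 1 - z.re ≠ 0 := (sub_pos.2 (show z.re < 1 from hz)).ne'
    apply Complex.ext
    · exact (re_ray.trans (sub_sub_cancel 1 z.re)).symm
    · simp only [Complex.sub_im, Complex.one_im, Complex.im_ofReal_mul, Complex.add_im,
        Complex.I_im, mul_one]
      field_simp
      ring
  rcases eq_empty_or_nonempty {z | z ∈ halfPlane ∧ (φ z).re = x} with he | ⟨z₀, hz₀, hx₀⟩
  · rw [he]; exact isPreconnected_empty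
  rw [hray z₀ hz₀] at hx₀
  choose ρ hρ hρx using hφ.exists_eq_of_eq (sub_pos.2 (show z₀.re < 1 from hz₀)) hx₀
  have hcont : Continuous ρ := by
    refine continuous_iff_continuousAt.2 fun m => tendsto_order.2 ⟨fun a ha => ?_, fun b hb => ?_⟩
    · have ha' : max a (ρ m / 2) < ρ m := max_lt ha (half_lt_self (hρ m))
      have h0 : 0 < max a (ρ m / 2) := lt_max_of_lt_right (half_pos (hρ m))
      have h1 := hφ.strictAntiOn m h0 (hρ m) ha'
      simp only [hρx] at h1
      filter_upwards [(hφ.continuous_slope h0).continuousAt.eventually_const_lt h1] with m' hm'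
      rw [← hρx m'] at hm'
      exact (le_max_left _ _).trans_lt
        (((hφ.strictAntiOn m').lt_iff_gt (hρ m') h0).1 hm')
    · have h0 : 0 < b := (hρ m).trans hb
      have h1 := hφ.strictAntiOn m (hρ m) h0 hb
      simp only [hρx] at h1
      filter_upwards [(hφ.continuous_slope h0).continuousAt.eventually_lt_const h1] with m' hm'
      rw [← hρx m'] at hm'
      exact ((hφ.strictAntiOn m').lt_iff_gt h0 (hρ m')).1 hm'
  have hrange : {z | z ∈ halfPlane ∧ (φ z).re = x} =
      range fun m : ℝ => (1 : ℂ) - ρ m * (1 + m * Complex.I) := by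
    ext z
    constructor
    · rintro ⟨hz, hzx⟩
      refine ⟨-z.im / (1 - z.re), ?_⟩
      have hr : 0 < 1 - z.re := sub_pos.2 hz
      rw [hray z hz] at hzx
      have := (hφ.strictAntiOn (-z.im / (1 - z.re))).injOn (hρ _) hr ((hρx _).trans hzx.symm)
      show (1 : ℂ) - ρ (-z.im / (1 - z.re)) * (1 + (-z.im / (1 - z.re) : ℝ) * Complex.I) = z
      rw [this]
      exact (hray z hz).symm
    · rintro ⟨m, rfl⟩
      exact ⟨ray_mem_halfPlane (hρ m), hρx m⟩
  rw [hrange]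
  exact isPreconnected_range (by fun_prop)

end RayDecreasing

/-! ### Shears that preserve vertical lines -/

lemma exists_im_sub_eq {G : ℂ → ℂ} {w : ℂ} {s : ℝ} (hs : 0 < s)
    (hd : ∀ y ∈ Icc 0 s, DifferentiableAt ℂ G (w + y * Complex.I)) :
    ∃ y ∈ Ioo 0 s, (G (w + s * Complex.I)).im - (G w).im =
      s * (deriv G (w + y * Complex.I)).re := by
  have hder : ∀ y ∈ Icc 0 s, HasDerivAt (fun y : ℝ => (G (w + y * Complex.I)).im)
      (deriv G (w + y * Complex.I)).re y := fun y hy => by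
    exact (Complex.imCLM.hasFDerivAt.comp_hasDerivAt y
      (hasDerivAt_comp_line (hd y hy))).congr_deriv (by simp)
  obtain ⟨y, hy, hslope⟩ := exists_hasDerivAt_eq_slope _ _ hs
    (fun t ht => (hder t ht).continuousAt.continuousWithinAt)
    fun t ht => hder t (Ioo_subset_Icc_self ht)
  refine ⟨y, hy, ?_⟩
  rw [hslope]
  simp only [Complex.ofReal_zero, zero_mul, add_zero, sub_zero]
  field_simp

lemma exists_vertical_segment {p : ℂ → Prop} {w : ℂ} (h : ∀ᶠ v in 𝓝 w, p v) :
    ∃ s : ℝ, 0 < s ∧ ∀ y ∈ Icc 0 s, p (w + y * Complex.I) := by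
  have hline : Filter.Tendsto (fun y : ℝ => w + (y : ℂ) * Complex.I) (𝓝 0) (𝓝 w) := by
    have : Continuous fun y : ℝ => w + (y : ℂ) * Complex.I := by fun_prop
    simpa using this.tendsto 0
  obtain ⟨s, hs, hsub⟩ := Metric.eventually_nhds_iff_ball.1 (hline.eventually h)
  refine ⟨s / 2, half_pos hs, fun y hy => hsub y ?_⟩
  rw [mem_ball_zero_iff, Real.norm_of_nonneg hy.1]
  linarith [hy.2]

/-- Lewy's theorem for the shear `w ↦ Re w + i Im G w`. Injectivity and convexity fix the sign of
the increments of `Im G` along vertical segments, hence that of `Re G'`; the open mapping theorem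
for `G'` then excludes a zero of `Re G'`. -/
lemma re_deriv_ne_zero_of_injOn {G : ℂ → ℂ} {w₀ : ℂ} {V : Set ℂ} (hV : V ∈ 𝓝 w₀)
    (hG : ∀ᶠ w in 𝓝 w₀, DifferentiableAt ℂ G w)
    (hinj : InjOn (fun w => (⟨w.re, (G w).im⟩ : ℂ)) V) : (deriv G w₀).re ≠ 0 := by
  intro h0
  obtain ⟨ε, hε, hball⟩ := Metric.mem_nhds_iff.1 (Filter.inter_mem hV hG)
  set B := Metric.ball w₀ ε
  have hdB : ∀ w ∈ B, DifferentiableAt ℂ G w := fun w hw => (hball hw).2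
  have hdo : DifferentiableOn ℂ G B := fun w hw => (hdB w hw).differentiableWithinAt
  have hBc : Convex ℝ B := convex_ball w₀ ε
  have hBo : IsOpen B := Metric.isOpen_ball
  have hw₀ : w₀ ∈ B := Metric.mem_ball_self hε
  -- the vertical segments in `B`, as pairs of base point and length
  set P : Set (ℂ × ℝ) := {p | p.1 ∈ B ∧ p.1 + p.2 * Complex.I ∈ B ∧ 0 < p.2}
  have hPc : Convex ℝ P := by
    intro p hp q hq a b ha hb hab
    refine ⟨hBc hp.1 hq.1 ha hb hab, ?_, convex_Ioi (0 : ℝ) hp.2.2 hq.2.2 ha hb hab⟩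
    convert hBc hp.2.1 hq.2.1 ha hb hab using 1
    simp
    ring
  set D : ℂ × ℝ → ℝ := fun p => (G (p.1 + p.2 * Complex.I)).im - (G p.1).im with hD
  have hDcont : ContinuousOn D P := by
    have hGc : ContinuousOn G B := hdo.continuousOn
    exact (Complex.continuous_im.comp_continuousOn
        (hGc.comp (by fun_prop) fun p hp => hp.2.1)).sub
      (Complex.continuous_im.comp_continuousOn (hGc.comp (by fun_prop) fun p hp => hp.1))
  have hDne : ∀ p ∈ P, D p ≠ 0 := fun p hp hzero => by
    have := hinj (hball hp.2.1).1 (hball hp.1).1 (by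
      apply Complex.ext
      · simp
      · exact sub_eq_zero.1 hzero)
    have hp2 := hp.2.2
    simp at this
    exact hp2.ne' this
  -- increments of `G` on short vertical segments from `w` have the sign of a nonzero `Re G' w`
  have hsign : ∀ σ : ℝ, (∀ p ∈ P, 0 < σ * D p) → ∀ w ∈ B, 0 ≤ σ * (deriv G w).re := by
    intro σ hσ w hw
    by_contra! hneg
    have hcont : ContinuousAt (fun w => σ * (deriv G w).re) w := by
      have := ((hdo.deriv hBo).differentiableAt (hBo.mem_nhds hw)).continuousAt
      exact continuousAt_const.mul (Complex.continuous_re.continuousAt.comp this)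
    obtain ⟨s, hs, hsub⟩ := exists_vertical_segment
      ((hBo.eventually_mem hw).and (hcont.eventually_lt_const hneg))
    obtain ⟨y, hy, heq⟩ := exists_im_sub_eq hs fun y hy => hdB _ (hsub y hy).1
    have h1 := hσ (w, s) ⟨hw, (hsub s (right_mem_Icc.2 hs.le)).1, hs⟩
    have h2 := (hsub y (Ioo_subset_Icc_self hy)).2
    simp only [hD] at h1
    rw [heq] at h1
    nlinarith
  have hconst : ∃ σ : ℝ, σ ≠ 0 ∧ ∀ p ∈ P, 0 < σ * D p := by
    by_cases hpos : ∀ p ∈ P, 0 < D p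
    · exact ⟨1, one_ne_zero, by simpa using hpos⟩
    · push Not at hpos
      obtain ⟨p, hp, hp0⟩ := hpos
      refine ⟨-1, by norm_num, fun q hq => ?_⟩
      by_contra! hq0
      obtain ⟨r, hr, hr0⟩ := hPc.isPreconnected.intermediate_value hp hq hDcont
        (show (0 : ℝ) ∈ Icc (D p) (D q) from ⟨hp0, by linarith⟩)
      exact hDne r hr hr0
  obtain ⟨σ, hσ0, hσ⟩ := hconst
  have hnonneg := hsign σ hσ
  have han : AnalyticAt ℂ (deriv G) w₀ := (hdo.deriv hBo).analyticAt (hBo.mem_nhds hw₀)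
  rcases han.eventually_constant_or_nhds_le_map_nhds with hc | hopen
  · obtain ⟨s, hs, hsub⟩ := exists_vertical_segment ((hBo.eventually_mem hw₀).and hc)
    obtain ⟨y, hy, heq⟩ := exists_im_sub_eq hs fun y hy => hdB _ (hsub y hy).1
    rw [(hsub y (Ioo_subset_Icc_self hy)).2, h0, mul_zero] at heq
    exact hDne (w₀, s) ⟨hw₀, (hsub s (right_mem_Icc.2 hs.le)).1, hs⟩ heq
  · have hmap : {v : ℂ | 0 ≤ σ * v.re} ∈ 𝓝 (deriv G w₀) :=
      hopen (Filter.mem_map.2 (Filter.mem_of_superset (hBo.mem_nhds hw₀) hnonneg))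
    obtain ⟨δ, hδ, hsub⟩ := Metric.mem_nhds_iff.1 hmap
    -- a small real displacement towards the side where `σ * Re < 0`
    have hlt : ‖((-(σ / |σ|) * (δ / 2) : ℝ) : ℂ)‖ < δ := by
      rw [Complex.norm_real, norm_mul, norm_neg, norm_div, Real.norm_eq_abs, Real.norm_eq_abs,
        abs_abs, div_self (abs_ne_zero.2 hσ0), one_mul, Real.norm_of_nonneg (by positivity)]
      exact half_lt_self hδ
    have h1 := hsub (show deriv G w₀ + ((-(σ / |σ|) * (δ / 2) : ℝ) : ℂ) ∈ Metric.ball _ δ by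
      simpa [mem_ball_iff_norm] using hlt)
    have h2 : 0 ≤ σ * (deriv G w₀ + ((-(σ / |σ|) * (δ / 2) : ℝ) : ℂ)).re := h1
    rw [Complex.add_re, h0, Complex.ofReal_re, zero_add] at h2
    have h3 : σ * (-(σ / |σ|) * (δ / 2)) = -(|σ| * (δ / 2)) := by
      have : |σ| ≠ 0 := abs_ne_zero.2 hσ0
      field_simp
      rw [sq_abs]
    have h4 : 0 < |σ| * (δ / 2) := mul_pos (abs_pos.2 hσ0) (half_pos hδ)
    linarith

/-- If `D` has connected vertical slices and `Re G' > 0` on `D`, then `w ↦ Re w + i Im G w` is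
injective on `D`. -/
lemma injOn_shear {G : ℂ → ℂ} {D : Set ℂ}
    (hslice : ∀ x : ℝ, IsPreconnected (D ∩ {w : ℂ | w.re = x}))
    (hd : ∀ w ∈ D, DifferentiableAt ℂ G w) (hpos : ∀ w ∈ D, 0 < (deriv G w).re) :
    InjOn (fun w => (⟨w.re, (G w).im⟩ : ℂ)) D := by
  have key : ∀ w ∈ D, ∀ s : ℝ, 0 < s → w + s * Complex.I ∈ D →
      (G (w + s * Complex.I)).im ≠ (G w).im := by
    intro w hw s hs hws heq
    have hmem : ∀ y ∈ Icc 0 s, w + (y : ℂ) * Complex.I ∈ D := fun y hy => by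
      have hoc := ((hslice w.re).image Complex.im Complex.continuous_im.continuousOn).ordConnected
      obtain ⟨v, ⟨hvD, hvre⟩, hvim⟩ := hoc.out ⟨w, ⟨hw, rfl⟩, rfl⟩
        ⟨w + s * Complex.I, ⟨hws, by simp⟩, rfl⟩
        (show w.im + y ∈ Icc _ _ from ⟨by linarith [hy.1], by simpa using hy.2⟩)
      have : v = w + (y : ℂ) * Complex.I := Complex.ext (by simpa using hvre) (by simpa using hvim)
      exact this ▸ hvD
    obtain ⟨y, hy, h⟩ := exists_im_sub_eq hs fun y hy => hd _ (hmem y hy)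
    rw [heq, sub_self] at h
    exact (mul_pos hs (hpos _ (hmem y (Ioo_subset_Icc_self hy)))).ne h
  intro w₁ h₁ w₂ h₂ heq
  obtain ⟨hre, him⟩ := Complex.ext_iff.1 heq
  simp only at hre him
  have hrep : ∀ a b : ℂ, a.re = b.re → a + ((b.im - a.im : ℝ) : ℂ) * Complex.I = b :=
    fun a b hab => Complex.ext (by simpa using hab) (by simp)
  rcases lt_trichotomy w₁.im w₂.im with h | h | h
  · have e := hrep w₁ w₂ hre
    exact absurd (by rw [e]; exact him.symm) (key w₁ h₁ _ (sub_pos.2 h) (by rw [e]; exact h₂))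
  · exact Complex.ext hre h
  · have e := hrep w₂ w₁ hre.symm
    exact absurd (by rw [e]; exact him) (key w₂ h₂ _ (sub_pos.2 h) (by rw [e]; exact h₁))

/-! ### Harmonic functions `h + c * conj g` -/

section Harmonic

variable {h g f : ℂ → ℂ} {c : ℝ}

/-- The real derivative of `h + c * conj g` in terms of the derivatives `a = h'` and `b = g'`. -/
noncomputable def harmonicDeriv (a b : ℂ) (c : ℝ) : ℂ →L[ℝ] ℂ :=
  (ContinuousLinearMap.toSpanSingleton ℂ a).restrictScalars ℝ +
    c • (Complex.conjCLE.toContinuousLinearMap.comp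
      ((ContinuousLinearMap.toSpanSingleton ℂ b).restrictScalars ℝ))

lemma harmonicDeriv_apply (a b : ℂ) (c : ℝ) (v : ℂ) :
    harmonicDeriv a b c v = a * v + c * (starRingEnd ℂ) (b * v) := by
  simp [harmonicDeriv, mul_comm]

lemma hasStrictFDerivAt_harmonic (hh : DifferentiableOn ℂ h halfPlane)
    (hg : DifferentiableOn ℂ g halfPlane)
    (hf : ∀ z ∈ halfPlane, f z = h z + c * (starRingEnd ℂ) (g z)) {z : ℂ} (hz : z ∈ halfPlane) :
    HasStrictFDerivAt f (harmonicDeriv (deriv h z) (deriv g z) c) z := by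
  have hn := isOpen_halfPlane.mem_nhds hz
  have dh := (hh.analyticAt hn).hasStrictDerivAt.hasStrictFDerivAt.restrictScalars ℝ
  have dg := (hg.analyticAt hn).hasStrictDerivAt.hasStrictFDerivAt.restrictScalars ℝ
  have dcg := Complex.conjCLE.toContinuousLinearMap.hasStrictFDerivAt.comp z dg
  refine (dh.add (dcg.const_smul c)).congr_of_eventuallyEq ?_
  filter_upwards [hn] with w hw
  simp [hf w hw]

lemma jacobian_eq (hh : DifferentiableOn ℂ h halfPlane) (hg : DifferentiableOn ℂ g halfPlane)
    (hf : ∀ z ∈ halfPlane, f z = h z + c * (starRingEnd ℂ) (g z)) {z : ℂ} (hz : z ∈ halfPlane) :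
    jacobian f z = ‖deriv h z‖ ^ 2 - c ^ 2 * ‖deriv g z‖ ^ 2 := by
  have hd := (hasStrictFDerivAt_harmonic hh hg hf hz).hasFDerivAt.fderiv
  have h1 : dz f z = deriv h z := by
    rw [dz, hd, harmonicDeriv_apply, harmonicDeriv_apply]
    simp only [map_mul, Complex.conj_I, mul_one]
    linear_combination (1 / 2 : ℂ) *
      (-deriv h z + c * (starRingEnd ℂ) (deriv g z)) * Complex.I_mul_I
  have h2 : dzbar f z = c * (starRingEnd ℂ) (deriv g z) := by
    rw [dzbar, hd, harmonicDeriv_apply, harmonicDeriv_apply]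
    simp only [map_mul, Complex.conj_I, mul_one]
    linear_combination (1 / 2 : ℂ) *
      (deriv h z - c * (starRingEnd ℂ) (deriv g z)) * Complex.I_mul_I
  rw [jacobian, h1, h2, norm_mul, Complex.norm_real, RCLike.norm_conj, mul_pow,
    Real.norm_eq_abs, sq_abs]

lemma harmonicDeriv_surjective {a b : ℂ} (hab : 0 < ‖a‖ ^ 2 - c ^ 2 * ‖b‖ ^ 2) :
    (harmonicDeriv a b c).range = ⊤ := by
  have hinj : Function.Injective (harmonicDeriv a b c).toLinearMap := by
    refine (injective_iff_map_eq_zero _).2 fun v hv => ?_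
    have hv' : a * v = -(c * (starRingEnd ℂ) (b * v)) :=
      eq_neg_of_add_eq_zero_left ((harmonicDeriv_apply a b c v).symm.trans hv)
    have hn := congrArg (fun w : ℂ => ‖w‖ ^ 2) hv'
    simp only [norm_neg, norm_mul, RCLike.norm_conj, Complex.norm_real, mul_pow,
      Real.norm_eq_abs, sq_abs] at hn
    have hmul : (‖a‖ ^ 2 - c ^ 2 * ‖b‖ ^ 2) * ‖v‖ ^ 2 = 0 := by linarith
    simpa using (mul_eq_zero.1 hmul).resolve_left hab.ne'
  exact LinearMap.range_eq_top.2 (LinearMap.injective_iff_surjective.1 hinj)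

/-- The shear argument of Clunie and Sheil-Small for `f = h + c * conj g` with
`φ = h + c * g`: in the coordinate `w = φ z`, the map `f` is `w ↦ Re w + i Im G w`, where
`G = (h - c * g) ∘ φ⁻¹`, and its Jacobian is `Re G'`. -/
theorem univalentOn_of_locallyUnivalentOn (hh : DifferentiableOn ℂ h halfPlane)
    (hg : DifferentiableOn ℂ g halfPlane) (hφ : RayDecreasing fun z => h z + c * g z)
    (hf : ∀ z ∈ halfPlane, f z = h z + c * (starRingEnd ℂ) (g z))
    (h0 : 0 < ‖deriv h 0‖ ^ 2 - c ^ 2 * ‖deriv g 0‖ ^ 2)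
    (hloc : LocallyUnivalentOn f halfPlane) :
    UnivalentOn f halfPlane ∧ ConvexInImaginaryDirection (f '' halfPlane) := by
  set φ : ℂ → ℂ := fun z => h z + c * g z with hφdef
  have dh : ∀ z ∈ halfPlane, HasDerivAt h (deriv h z) z := fun z hz =>
    (hh.differentiableAt (isOpen_halfPlane.mem_nhds hz)).hasDerivAt
  have dg : ∀ z ∈ halfPlane, HasDerivAt g (deriv g z) z := fun z hz =>
    (hg.differentiableAt (isOpen_halfPlane.mem_nhds hz)).hasDerivAt
  have dφ : ∀ z ∈ halfPlane, deriv φ z = deriv h z + c * deriv g z := fun z hz =>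
    ((dh z hz).add ((dg z hz).const_mul (c : ℂ))).deriv
  have sφ : ∀ z ∈ halfPlane, HasStrictDerivAt φ (deriv φ z) z := fun z hz =>
    (hφ.differentiableOn.analyticAt (isOpen_halfPlane.mem_nhds hz)).hasStrictDerivAt
  have nφ : ∀ z ∈ halfPlane, Filter.map φ (𝓝 z) = 𝓝 (φ z) := fun z hz =>
    (sφ z hz).map_nhds_eq (hφ.deriv_ne_zero hz)
  set ψ : ℂ → ℂ := Function.invFunOn φ halfPlane
  have hψ : ∀ z ∈ halfPlane, ψ (φ z) = z := hφ.injOn.leftInvOn_invFunOn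
  have dψ : ∀ z ∈ halfPlane, HasDerivAt ψ (deriv φ z)⁻¹ (φ z) := fun z hz =>
    ((sφ z hz).to_local_left_inverse (hφ.deriv_ne_zero hz)
      (Filter.eventually_of_mem (isOpen_halfPlane.mem_nhds hz) hψ)).hasDerivAt
  set G : ℂ → ℂ := fun w => h (ψ w) - c * g (ψ w) with hGdef
  have dG : ∀ z ∈ halfPlane, HasDerivAt G
      ((deriv h z - c * deriv g z) * (deriv φ z)⁻¹) (φ z) := fun z hz => by
    have h1 : HasDerivAt (fun z => h z - c * g z) (deriv h z - c * deriv g z) (ψ (φ z)) := by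
      rw [hψ z hz]
      exact (dh z hz).sub ((dg z hz).const_mul (c : ℂ))
    exact h1.comp (φ z) (dψ z hz)
  have hfF : ∀ z ∈ halfPlane, f z = ⟨(φ z).re, (G (φ z)).im⟩ := fun z hz => by
    rw [hf z hz]
    apply Complex.ext
    · simp [hφdef]
    · simp only [hGdef, hψ z hz]
      simp [sub_eq_add_neg]
  have hne : ∀ z ∈ halfPlane, ((deriv h z - c * deriv g z) * (deriv φ z)⁻¹).re ≠ 0 := by
    intro z hz
    obtain ⟨V, hV, hinj⟩ := hloc z hz
    have hn := isOpen_halfPlane.mem_nhds hz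
    rw [← (dG z hz).deriv]
    refine re_deriv_ne_zero_of_injOn (V := φ '' (V ∩ halfPlane)) ?_ ?_ ?_
    · rw [← nφ z hz]
      exact Filter.image_mem_map (Filter.inter_mem hV hn)
    · rw [← nφ z hz, Filter.eventually_map]
      filter_upwards [hn] with w hw using (dG w hw).differentiableAt
    · rintro _ ⟨a, ha, rfl⟩ _ ⟨b, hb, rfl⟩ hab
      simp only [← hfF a ha.2, ← hfF b hb.2] at hab
      rw [hinj ha.1 hb.1 hab]
  have hnorm : ∀ z ∈ halfPlane, ‖deriv h z‖ ^ 2 - c ^ 2 * ‖deriv g z‖ ^ 2 =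
      Complex.normSq (deriv φ z) * ((deriv h z - c * deriv g z) * (deriv φ z)⁻¹).re := by
    intro z hz
    have h1 : Complex.normSq (deriv φ z) ≠ 0 :=
      (Complex.normSq_pos.2 (hφ.deriv_ne_zero hz)).ne'
    rw [← Complex.re_ofReal_mul, Complex.inv_def]
    have : (Complex.normSq (deriv φ z) : ℂ) * ((deriv h z - c * deriv g z) *
        ((starRingEnd ℂ) (deriv φ z) * (((Complex.normSq (deriv φ z))⁻¹ : ℝ) : ℂ))) =
        (deriv h z - c * deriv g z) * (starRingEnd ℂ) (deriv φ z) := by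
      have : (Complex.normSq (deriv φ z) : ℂ) ≠ 0 := by exact_mod_cast h1
      push_cast
      field_simp
    rw [this, dφ z hz, ← Complex.normSq_eq_norm_sq, ← Complex.normSq_eq_norm_sq,
      Complex.normSq_apply, Complex.normSq_apply]
    simp
    ring
  have hpos : ∀ z ∈ halfPlane, 0 < ((deriv h z - c * deriv g z) * (deriv φ z)⁻¹).re := by
    intro z hz
    by_contra! hle
    have hq0 : 0 ≤ ((deriv h 0 - c * deriv g 0) * (deriv φ 0)⁻¹).re := by
      rw [hnorm 0 zero_mem_halfPlane] at h0
      exact (pos_of_mul_pos_right h0 (Complex.normSq_nonneg _)).le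
    have hcont : ContinuousOn
        (fun z => ((deriv h z - c * deriv g z) * (deriv φ z)⁻¹).re) halfPlane :=
      Complex.continuous_re.comp_continuousOn <|
        ((hh.deriv isOpen_halfPlane).continuousOn.sub
          ((hg.deriv isOpen_halfPlane).continuousOn.const_mul _)).mul
        ((hφ.differentiableOn.deriv isOpen_halfPlane).continuousOn.inv₀
          fun z hz => hφ.deriv_ne_zero hz)
    obtain ⟨w, hw, hw0⟩ := convex_halfPlane.isPreconnected.intermediate_value hz
      zero_mem_halfPlane hcont ⟨hle, hq0⟩
    exact hne w hw hw0
  have hJ : ∀ z ∈ halfPlane, 0 < ‖deriv h z‖ ^ 2 - c ^ 2 * ‖deriv g z‖ ^ 2 := fun z hz => by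
    rw [hnorm z hz]
    exact mul_pos (Complex.normSq_pos.2 (hφ.deriv_ne_zero hz)) (hpos z hz)
  have hslice : ∀ x : ℝ, IsPreconnected (φ '' halfPlane ∩ {w : ℂ | w.re = x}) := fun x => by
    rw [← image_inter_preimage]
    exact (hφ.isPreconnected_level x).image φ
      (hφ.differentiableOn.continuousOn.mono fun z hz => hz.1)
  have hfc : ContinuousOn f halfPlane := fun z hz =>
    (hasStrictFDerivAt_harmonic hh hg hf hz).hasFDerivAt.continuousAt.continuousWithinAt
  have hshear := injOn_shear hslice (G := G)
    (by rintro _ ⟨z, hz, rfl⟩; exact (dG z hz).differentiableAt)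
    (by rintro _ ⟨z, hz, rfl⟩; rw [(dG z hz).deriv]; exact hpos z hz)
  refine ⟨⟨fun a ha b hb hab => ?_, fun z hz => ?_⟩, ?_, ?_, fun x => ?_⟩
  · rw [hfF a ha, hfF b hb] at hab
    exact hφ.injOn ha hb (hshear (mem_image_of_mem φ ha) (mem_image_of_mem φ hb) hab)
  · rw [jacobian_eq hh hg hf hz]
    exact hJ z hz
  · rw [isOpen_iff_mem_nhds]
    rintro _ ⟨z, hz, rfl⟩
    rw [← (hasStrictFDerivAt_harmonic hh hg hf hz).map_nhds_eq_of_surj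
      (harmonicDeriv_surjective (hJ z hz))]
    exact Filter.image_mem_map (isOpen_halfPlane.mem_nhds hz)
  · exact ⟨⟨_, mem_image_of_mem f zero_mem_halfPlane⟩,
      convex_halfPlane.isPreconnected.image f hfc⟩
  · have : f '' halfPlane ∩ {w : ℂ | w.re = x} =
        f '' {z | z ∈ halfPlane ∧ (φ z).re = x} := by
      rw [← image_inter_preimage]
      congr 1
      ext z
      refine and_congr_right fun hz => ?_
      simp [hfF z hz]
    rw [this]
    exact (hφ.isPreconnected_level x).image f (hfc.mono fun z hz => hz.1)

end Harmonic

end HausdorffHarmonic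

theorem theorem1p4 (c : ℝ) (hc0 : 0 ≤ c) (hc1 : c < 1) (f : ℂ → ℂ)
    (hf : f ∈ HausdorffHarmonic.classHT (c : ℂ))
    (hloc : HausdorffHarmonic.LocallyUnivalentOn f HausdorffHarmonic.halfPlane) :
    HausdorffHarmonic.UnivalentOn f HausdorffHarmonic.halfPlane ∧
      HausdorffHarmonic.ConvexInImaginaryDirection (f '' HausdorffHarmonic.halfPlane) := by
  obtain ⟨h, hh, g, hg, hfe⟩ := hf
  obtain ⟨μ, _, hμ⟩ := HausdorffHarmonic.exists_eqOn_stieltjes hh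
  obtain ⟨ν, _, hν⟩ := HausdorffHarmonic.exists_eqOn_stieltjes hg
  refine HausdorffHarmonic.univalentOn_of_locallyUnivalentOn
    (HausdorffHarmonic.differentiableOn_stieltjes μ)
    (HausdorffHarmonic.differentiableOn_stieltjes ν)
    ((HausdorffHarmonic.rayDecreasing_stieltjes μ).add_const_mul
      (HausdorffHarmonic.rayDecreasing_stieltjes ν) hc0)
    (fun z hz => ?_) ?_ hloc
  · rw [hfe z (HausdorffHarmonic.halfPlane_subset_slitDomain hz), hμ hz, hν hz]
  · rw [HausdorffHarmonic.deriv_stieltjes_zero, HausdorffHarmonic.deriv_stieltjes_zero]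
    simp only [norm_one]
    nlinarith
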